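/- Let $q$ be a prime power, let $\mathbb{F}_q$ be the field with $q$ elements, and let $m(x) = x^3 + ax^2 + bx + c \in \mathbb{F}_q[x]$ be a monic irreducible cubic polynomial. Let $\mathcal{C}(m)$ be the set of all $3 \times 3$ matrices over $\mathbb{F}_q$ whose minimal polynomial is $m$. Let $\Gamma_m$ be the simple graph with vertex set $V(\Gamma_m) = \mathcal{C}(m)$ in which two vertices $A, B$ are adjacent if and only if the matrix $A - B$ is invertible. Then: 1. $|V(\Gamma_m)| = (q^3 - q)(q^3 - q^2)$. 2. $\Gamma_m$ is vertex-transitive, that is, for all vertices $A, B$ there is a graph automorphism of $\Gamma_m$ mapping $A$ to $B$. 3. $\Gamma_m$ is regular of degree $(q^3 - q^2 - q)(q^3 - q^2 - q - 1)$. 4. $\Gamma_m$ contains a clique of size $q^3 - q^2 - q$, that is, a set of $q^3 - q^2 - q$ pairwise adjacent vertices. -/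

import Mathlib

open Polynomial

/-- `𝒞ₙ(f)`: the `n × n` matrices over `F` whose minimal polynomial is `f`. -/
def minpolyClass {F : Type*} [Field F] (n : ℕ) (f : F[X]) : Set (Matrix (Fin n) (Fin n) F) :=
  {A | minpoly F A = f}

/-- The invertible difference graph `Γ_m`: its vertices are the elements of `𝒞(m) = 𝒞₃(m)`, and
`A ∼ B` if and only if `A - B` is invertible. -/
def invDiffGraph {F : Type*} [Field F] (m : F[X]) : SimpleGraph (minpolyClass 3 m) where
  Adj A B := IsUnit ((A : Matrix (Fin 3) (Fin 3) F) - (B : Matrix (Fin 3) (Fin 3) F))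
  symm := ⟨fun A B h => by
    rw [← neg_sub]
    exact h.neg⟩
  loopless := ⟨fun A h => by
    rw [sub_self] at h
    exact not_isUnit_zero h⟩

/-- Over a finite field every vertex has finitely many neighbours, so degrees make sense. -/
noncomputable instance invDiffGraphLocallyFinite {F : Type*} [Field F] [Finite F] (m : F[X]) :
    (invDiffGraph m).LocallyFinite :=
  fun _ => Fintype.ofFinite _

/-- A graph is vertex-transitive if its automorphism group acts transitively on the vertices. -/
def IsVertexTransitive {V : Type*} (G : SimpleGraph V) : Prop :=
  ∀ v w : V, ∃ φ : G ≃g G, φ v = w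

/-! ### Endomorphisms with irreducible cubic minimal polynomial -/

section IrreducibleMinpoly

variable {F V : Type*} [Field F] [AddCommGroup V] [Module F V] {m : F[X]}

/-! If `T` has minimal polynomial `m`, every nonzero `v` is cyclic, so `T` amounts to a basis `(u,
w, v)` with `w = T v`, `u = T w`. For fixed `v`, choosing `w` and then `u` counts the vertices;
matching two such bases conjugates any vertex to any other.

For the degree, distinct vertices differ by a map with kernel of dimension at most 1
(`finrank_ker_sub_le_one`), so counting pairs `(v, S)` with `T v = S v` gives the number of singular
differences.

For the clique, let `K = F[x]/(m)` with root `α`, and conjugate multiplication by `α` by the maps `x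
↦ x - κ x^q`. Differences of these conjugates factor into units. At most `q² + q + 1` values of `κ`
are bad, and multiplication by `α^q` supplies one more vertex. -/

theorem aeval_apply_ne_zero_of_minpoly_irreducible (hirr : Irreducible m) {T : Module.End F V}
    (hT : minpoly F T = m) {p : F[X]} (hp : p ≠ 0) (hpm : p.natDegree < m.natDegree) {v : V}
    (hv : v ≠ 0) : aeval T p v ≠ 0 := by
  intro h
  have hcop : IsCoprime m p := hirr.coprime_iff_not_dvd.2
    fun hd => absurd (natDegree_le_of_dvd hd hp) (not_le.2 hpm)
  obtain ⟨a, b, hab⟩ := hcop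
  have hm : aeval T m = 0 := by rw [← hT, minpoly.aeval]
  have := congrArg (fun r => aeval T r v) hab
  simp only [map_add, map_mul, hm, mul_zero, zero_add, Module.End.mul_apply, h, map_zero,
    map_one, Module.End.one_apply] at this
  exact hv this.symm

theorem linearIndependent_orbit (hirr : Irreducible m) (hdeg : m.natDegree = 3)
    {T : Module.End F V} (hT : minpoly F T = m) {v : V} (hv : v ≠ 0) :
    LinearIndependent F ![T (T v), T v, v] := by
  rw [Fintype.linearIndependent_iff]
  intro g hg
  simp only [Fin.sum_univ_three, Matrix.cons_val] at hg
  -- A linear relation on the orbit is a polynomial of degree at most 2 in `T` that kills `v`.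
  have hp : C (g 0) * X ^ 2 + C (g 1) * X + C (g 2) = 0 := by
    by_contra hp
    refine aeval_apply_ne_zero_of_minpoly_irreducible hirr hT hp
      (by rw [hdeg]; exact Nat.lt_succ_of_le natDegree_quadratic_le) hv ?_
    simpa [pow_two, Module.algebraMap_end_apply] using hg
  have h0 := congrArg (fun p => coeff p 2) hp
  have h1 := congrArg (fun p => coeff p 1) hp
  have h2 := congrArg (fun p => coeff p 0) hp
  simp [coeff_X, coeff_C] at h0 h1 h2
  intro i
  fin_cases i <;> simpa

theorem aeval_cubic_apply (hmonic : m.Monic) (hdeg : m.natDegree = 3) (T : Module.End F V)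
    (v : V) :
    aeval T m v = m.coeff 0 • v + m.coeff 1 • T v + m.coeff 2 • T (T v) + T (T (T v)) := by
  have h3 : m.coeff 3 = 1 := by rw [← hdeg]; exact hmonic
  rw [aeval_eq_sum_range, hdeg]
  simp [Finset.sum_range_succ, h3, pow_succ]

theorem apply_apply_apply_eq (hmonic : m.Monic) (hdeg : m.natDegree = 3) {T : Module.End F V}
    (hT : minpoly F T = m) (v : V) :
    T (T (T v)) = -(m.coeff 0 • v + m.coeff 1 • T v + m.coeff 2 • T (T v)) := by
  have h := aeval_cubic_apply hmonic hdeg T v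
  rw [← hT, minpoly.aeval, hT] at h
  exact eq_neg_of_add_eq_zero_right h.symm

/-- The basis of a three-dimensional space given by a linearly independent triple. -/
noncomputable def tripleBasis (hV : Module.finrank F V = 3) {u w v : V}
    (h : LinearIndependent F ![u, w, v]) : Module.Basis (Fin 3) F V :=
  basisOfLinearIndependentOfCardEqFinrank h (by simp [hV])

theorem coe_tripleBasis (hV : Module.finrank F V = 3) {u w v : V}
    (h : LinearIndependent F ![u, w, v]) : ⇑(tripleBasis hV h) = ![u, w, v] := by
  simp [tripleBasis]

theorem linearMap_ext_triple {V' : Type*} [AddCommGroup V'] [Module F V']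
    (hV : Module.finrank F V = 3) {u w v : V}
    (h : LinearIndependent F ![u, w, v]) {f g : V →ₗ[F] V'} (hu : f u = g u) (hw : f w = g w)
    (hv : f v = g v) : f = g := by
  refine (tripleBasis hV h).ext fun i => ?_
  rw [coe_tripleBasis]
  fin_cases i <;> simpa

theorem eq_of_minpoly_eq_of_apply_eq (hmonic : m.Monic) (hirr : Irreducible m)
    (hdeg : m.natDegree = 3) (hV : Module.finrank F V = 3) {T S : Module.End F V}
    (hT : minpoly F T = m) (hS : minpoly F S = m) {v : V} (hv : v ≠ 0) (h1 : T v = S v)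
    (h2 : T (T v) = S (T v)) : T = S := by
  refine linearMap_ext_triple hV (linearIndependent_orbit hirr hdeg hT hv) ?_ h2 h1
  rw [apply_apply_apply_eq hmonic hdeg hT, h2, h1, apply_apply_apply_eq hmonic hdeg hS]

theorem exists_minpoly_eq_of_linearIndependent (hmonic : m.Monic) (hirr : Irreducible m)
    (hdeg : m.natDegree = 3) (hV : Module.finrank F V = 3) {u w v : V}
    (h : LinearIndependent F ![u, w, v]) :
    ∃ T : Module.End F V, minpoly F T = m ∧ T v = w ∧ T w = u := by
  set b := tripleBasis hV h with hb
  have hbc := coe_tripleBasis hV h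
  rw [← hb] at hbc
  let T : Module.End F V :=
    b.constr F ![-(m.coeff 0 • v + m.coeff 1 • w + m.coeff 2 • u), u, w]
  have hTu : T u = -(m.coeff 0 • v + m.coeff 1 • w + m.coeff 2 • u) := by
    have := b.constr_basis F ![-(m.coeff 0 • v + m.coeff 1 • w + m.coeff 2 • u), u, w] 0
    rw [hbc] at this
    exact this
  have hTw : T w = u := by
    have := b.constr_basis F ![-(m.coeff 0 • v + m.coeff 1 • w + m.coeff 2 • u), u, w] 1
    rw [hbc] at this
    exact this
  have hTv : T v = w := by
    have := b.constr_basis F ![-(m.coeff 0 • v + m.coeff 1 • w + m.coeff 2 • u), u, w] 2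
    rw [hbc] at this
    exact this
  refine ⟨T, ?_, hTv, hTw⟩
  -- `T` commutes with `aeval T m`, so killing `v` forces killing the whole basis.
  have hcomm : ∀ x, aeval T m (T x) = T (aeval T m x) := fun x => by
    simp only [aeval_cubic_apply hmonic hdeg, map_add, map_smul]
  have hv0 : aeval T m v = 0 := by
    rw [aeval_cubic_apply hmonic hdeg, hTv, hTw, hTu, add_neg_cancel]
  have hw0 : aeval T m w = 0 := by rw [← hTv, hcomm, hv0, map_zero]
  have hu0 : aeval T m u = 0 := by rw [← hTw, hcomm, hw0, map_zero]
  have : Nontrivial V := ⟨v, 0, h.ne_zero 2⟩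
  refine (minpoly.eq_of_irreducible_of_monic hirr ?_ hmonic).symm
  exact linearMap_ext_triple hV h hu0 hw0 hv0

theorem exists_conj_of_minpoly_eq (hmonic : m.Monic) (hirr : Irreducible m)
    (hdeg : m.natDegree = 3) (hV : Module.finrank F V = 3) {T S : Module.End F V}
    (hT : minpoly F T = m) (hS : minpoly F S = m) :
    ∃ e : V ≃ₗ[F] V, LinearEquiv.conjAlgEquiv F e T = S := by
  have : Nontrivial V := Module.nontrivial_of_finrank_pos (R := F) (by omega)
  obtain ⟨v, hv⟩ := exists_ne (0 : V)
  have hLT := linearIndependent_orbit hirr hdeg hT hv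
  have hLS := linearIndependent_orbit hirr hdeg hS hv
  let e : V ≃ₗ[F] V := (tripleBasis hV hLT).equiv (tripleBasis hV hLS) (Equiv.refl _)
  have he : ∀ i, e (![T (T v), T v, v] i) = ![S (S v), S v, v] i := fun i => by
    rw [← coe_tripleBasis hV hLT, ← coe_tripleBasis hV hLS]
    simp [e]
  have h0 : e (T (T v)) = S (S v) := he 0
  have h1 : e (T v) = S v := he 1
  have h2 : e v = v := he 2
  refine ⟨e, ?_⟩
  have key : e.toLinearMap ∘ₗ T = S ∘ₗ e.toLinearMap := by
    refine linearMap_ext_triple hV hLT ?_ ?_ ?_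
    · simp [apply_apply_apply_eq hmonic hdeg hT, apply_apply_apply_eq hmonic hdeg hS, h0, h1, h2]
    · simp [h0, h1]
    · simp [h1, h2]
  ext x
  have := LinearMap.congr_fun key (e.symm x)
  simpa using this

/-- If `x ≠ 0` and `T x` both lay in the kernel `W`, then `T = S`. Hence `W` and `T W` are disjoint
of equal dimension, and `2 dim W ≤ 3`. -/
theorem finrank_ker_sub_le_one (hmonic : m.Monic) (hirr : Irreducible m)
    (hdeg : m.natDegree = 3) (hV : Module.finrank F V = 3) {T S : Module.End F V}
    (hT : minpoly F T = m) (hS : minpoly F S = m) (hne : T ≠ S) :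
    Module.finrank F (LinearMap.ker (T - S)) ≤ 1 := by
  have : FiniteDimensional F V := Module.finite_of_finrank_pos (by omega)
  have hinj : Function.Injective T := by
    rw [← LinearMap.ker_eq_bot, LinearMap.ker_eq_bot']
    intro x hx
    by_contra hx0
    exact (linearIndependent_orbit hirr hdeg hT hx0).ne_zero 1 hx
  set W := LinearMap.ker (T - S)
  have hdis : Disjoint W (W.map T) := by
    rw [Submodule.disjoint_def]
    rintro _ hTx ⟨x, hx, rfl⟩
    by_contra h0
    have hx0 : x ≠ 0 := by rintro rfl; simp at h0
    have hx' : x ∈ W := hx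
    rw [LinearMap.mem_ker, LinearMap.sub_apply, sub_eq_zero] at hx' hTx
    exact hne (eq_of_minpoly_eq_of_apply_eq hmonic hirr hdeg hV hT hS hx0 hx' hTx)
  have h1 := Submodule.finrank_add_finrank_le_of_disjoint hdis
  have h2 : Module.finrank F (W.map T) = Module.finrank F W :=
    (Submodule.equivMapOfInjective T hinj W).finrank_eq.symm
  omega

end IrreducibleMinpoly

theorem Set.ncard_eq_mul_of_ncard_fiber {α β : Type*} [Finite α] [Finite β] {s : Set α}
    {t : Set β} {f : α → β} (hf : Set.MapsTo f s t) {c : ℕ}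
    (h : ∀ b ∈ t, {a | a ∈ s ∧ f a = b}.ncard = c) : s.ncard = t.ncard * c := by
  classical
  have hs := s.toFinite
  have ht := t.toFinite
  rw [Set.ncard_eq_toFinset_card s, Set.ncard_eq_toFinset_card t,
    Finset.card_eq_sum_card_fiberwise (f := f) (t := ht.toFinset) (by simpa using hf),
    Finset.sum_const_nat (m := c)]
  intro b hb
  rw [← h b (by simpa using hb), ← Set.ncard_coe_finset]
  congr 1
  ext a
  simp

/-! ### Vertex count and degree -/

section Counting

variable {F V : Type*} [Field F] [Finite F] [AddCommGroup V] [Module F V] {m : F[X]}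

theorem ncard_compl_submodule [FiniteDimensional F V] (W : Submodule F V) :
    {u : V | u ∉ W}.ncard =
      Nat.card F ^ Module.finrank F V - Nat.card F ^ Module.finrank F W := by
  have : Finite V := Module.finite_of_finite F
  rw [← Module.natCard_eq_pow_finrank, ← Module.natCard_eq_pow_finrank]
  exact Set.ncard_compl (W : Set V)

theorem ncard_linearIndependent_triple (hV : Module.finrank F V = 3) {w v : V}
    (h : LinearIndependent F ![w, v]) :
    {u : V | LinearIndependent F ![u, w, v]}.ncard = Nat.card F ^ 3 - Nat.card F ^ 2 := by
  have : FiniteDimensional F V := Module.finite_of_finrank_pos (by omega)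
  have h2 := finrank_span_eq_card h
  have := ncard_compl_submodule (Submodule.span F (Set.range ![w, v]))
  rw [h2, hV, Fintype.card_fin] at this
  rw [← this]
  congr 1
  ext u
  exact linearIndependent_finCons.trans (and_iff_right h)

theorem ncard_linearIndependent_pair (hV : Module.finrank F V = 3) {v : V} (hv : v ≠ 0) :
    {w : V | LinearIndependent F ![w, v]}.ncard = Nat.card F ^ 3 - Nat.card F := by
  have : FiniteDimensional F V := Module.finite_of_finrank_pos (by omega)
  have h : LinearIndependent F ![v] := LinearIndependent.of_subsingleton 0 hv
  have h2 := finrank_span_eq_card h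
  have := ncard_compl_submodule (Submodule.span F (Set.range ![v]))
  rw [h2, hV, Fintype.card_fin, pow_one] at this
  rw [← this]
  congr 1
  ext u
  exact linearIndependent_finCons.trans (and_iff_right h)

theorem linearIndependent_pair_orbit {F V : Type*} [Field F] [AddCommGroup V] [Module F V]
    {m : F[X]} (hirr : Irreducible m) (hdeg : m.natDegree = 3)
    {T : Module.End F V} (hT : minpoly F T = m) {v : V} (hv : v ≠ 0) :
    LinearIndependent F ![T v, v] :=
  (linearIndependent_finCons.1 (linearIndependent_orbit hirr hdeg hT hv)).1

theorem ncard_minpoly_eq_apply_eq (hmonic : m.Monic) (hirr : Irreducible m)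
    (hdeg : m.natDegree = 3) (hV : Module.finrank F V = 3) {w v : V}
    (h : LinearIndependent F ![w, v]) :
    {T : Module.End F V | minpoly F T = m ∧ T v = w}.ncard =
      Nat.card F ^ 3 - Nat.card F ^ 2 := by
  have hv : v ≠ 0 := h.ne_zero 1
  rw [← ncard_linearIndependent_triple hV h]
  refine Set.ncard_congr (fun T _ => T w) ?_ ?_ ?_
  · rintro T ⟨hT, rfl⟩
    exact linearIndependent_orbit hirr hdeg hT hv
  · rintro T S ⟨hT, rfl⟩ ⟨hS, hSv⟩ hTS
    refine eq_of_minpoly_eq_of_apply_eq hmonic hirr hdeg hV hT hS hv hSv.symm hTS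
  · rintro u hu
    obtain ⟨T, hT, hTv, hTw⟩ := exists_minpoly_eq_of_linearIndependent hmonic hirr hdeg hV hu
    exact ⟨T, ⟨hT, hTv⟩, hTw⟩

theorem ncard_minpoly_eq (hmonic : m.Monic) (hirr : Irreducible m)
    (hdeg : m.natDegree = 3) (hV : Module.finrank F V = 3) :
    {T : Module.End F V | minpoly F T = m}.ncard =
      (Nat.card F ^ 3 - Nat.card F) * (Nat.card F ^ 3 - Nat.card F ^ 2) := by
  have : FiniteDimensional F V := Module.finite_of_finrank_pos (by omega)
  have : Finite V := Module.finite_of_finite F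
  have : Finite (Module.End F V) := Module.finite_of_finite F
  have : Nontrivial V := Module.nontrivial_of_finrank_pos (R := F) (by omega)
  obtain ⟨v, hv⟩ := exists_ne (0 : V)
  rw [← ncard_linearIndependent_pair hV hv]
  exact Set.ncard_eq_mul_of_ncard_fiber (s := {T : Module.End F V | minpoly F T = m})
    (t := {w : V | LinearIndependent F ![w, v]}) (f := fun T => T v)
    (fun T hT => linearIndependent_pair_orbit hirr hdeg hT hv)
    fun w hw => ncard_minpoly_eq_apply_eq hmonic hirr hdeg hV hw

/-- Double counting: each `v ≠ 0` admits `q³ - q² - 1` maps `S ≠ T` agreeing with `T` at `v`, while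
each singular `T - S` has a kernel line with `q - 1` nonzero vectors. -/
theorem ncard_minpoly_eq_singular_sub_mul (hmonic : m.Monic) (hirr : Irreducible m)
    (hdeg : m.natDegree = 3) (hV : Module.finrank F V = 3) {T : Module.End F V}
    (hT : minpoly F T = m) :
    {S : Module.End F V | minpoly F S = m ∧ S ≠ T ∧ ¬ IsUnit (T - S)}.ncard *
        (Nat.card F - 1) =
      (Nat.card F ^ 3 - 1) * (Nat.card F ^ 3 - Nat.card F ^ 2 - 1) := by
  have : FiniteDimensional F V := Module.finite_of_finrank_pos (by omega)
  have : Finite V := Module.finite_of_finite F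
  have : Finite (Module.End F V) := Module.finite_of_finite F
  let P : Set (V × Module.End F V) := {p | p.1 ≠ 0 ∧ minpoly F p.2 = m ∧ p.2 ≠ T ∧ T p.1 = p.2 p.1}
  have h1 : P.ncard = {v : V | v ∉ (⊥ : Submodule F V)}.ncard *
      (Nat.card F ^ 3 - Nat.card F ^ 2 - 1) := by
    refine Set.ncard_eq_mul_of_ncard_fiber (f := Prod.fst) (fun p hp => hp.1) fun v hv => ?_
    have hv : v ≠ 0 := hv
    rw [← ncard_minpoly_eq_apply_eq hmonic hirr hdeg hV
      (linearIndependent_pair_orbit hirr hdeg hT hv),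
      ← Set.ncard_sdiff_singleton_of_mem (a := T)
        (show T ∈ {S : Module.End F V | minpoly F S = m ∧ S v = T v} from ⟨hT, rfl⟩)]
    refine Set.ncard_congr (fun p _ => p.2) ?_ ?_ ?_
    · rintro ⟨v', S⟩ ⟨⟨-, hS, hne, hvS⟩, rfl⟩
      exact ⟨⟨hS, hvS.symm⟩, hne⟩
    · rintro ⟨v₁, S₁⟩ ⟨v₂, S₂⟩ ⟨-, rfl⟩ ⟨-, rfl⟩ h
      exact Prod.ext rfl h
    · rintro S ⟨⟨hS, hvS⟩, hne⟩
      exact ⟨(v, S), ⟨⟨hv, hS, hne, hvS.symm⟩, rfl⟩, rfl⟩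
  have h2 : P.ncard =
      {S : Module.End F V | minpoly F S = m ∧ S ≠ T ∧ ¬ IsUnit (T - S)}.ncard *
        (Nat.card F - 1) := by
    refine Set.ncard_eq_mul_of_ncard_fiber (f := Prod.snd) ?_ ?_
    · rintro ⟨v, S⟩ ⟨hv, hS, hne, hvS⟩
      refine ⟨hS, hne, fun hu => hv ?_⟩
      rw [LinearMap.isUnit_iff_ker_eq_bot, LinearMap.ker_eq_bot'] at hu
      exact hu v (sub_eq_zero.2 hvS)
    · rintro S ⟨hS, hne, hu⟩
      have hle := finrank_ker_sub_le_one hmonic hirr hdeg hV hT hS hne.symm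
      have hpos : Module.finrank F (LinearMap.ker (T - S)) ≠ 0 := fun h0 =>
        hu ((LinearMap.isUnit_iff_ker_eq_bot _).2 (Submodule.finrank_eq_zero.1 h0))
      have hrank : Module.finrank F (LinearMap.ker (T - S)) = 1 := by omega
      have hker : ((LinearMap.ker (T - S) : Set V) \ {0}).ncard = Nat.card F - 1 := by
        rw [Set.ncard_sdiff_singleton_of_mem (Submodule.zero_mem _)]
        congr 1
        rw [← pow_one (Nat.card F), ← hrank, ← Module.natCard_eq_pow_finrank]
        rfl
      rw [← hker]
      refine Set.ncard_congr (fun p _ => p.1) ?_ ?_ ?_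
      · rintro ⟨v, S'⟩ ⟨⟨hv, -, -, hvS⟩, rfl⟩
        exact ⟨sub_eq_zero.2 hvS, hv⟩
      · rintro ⟨v₁, S₁⟩ ⟨v₂, S₂⟩ ⟨-, rfl⟩ ⟨-, rfl⟩ h
        exact Prod.ext h rfl
      · rintro v ⟨hvS, hv⟩
        exact ⟨(v, S), ⟨⟨hv, hS, hne, sub_eq_zero.1 hvS⟩, rfl⟩, rfl⟩
  rw [← h2, h1, ncard_compl_submodule, hV, finrank_bot, pow_zero]

theorem ncard_minpoly_eq_isUnit_sub (hmonic : m.Monic) (hirr : Irreducible m)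
    (hdeg : m.natDegree = 3) (hV : Module.finrank F V = 3) {T : Module.End F V}
    (hT : minpoly F T = m) :
    {S : Module.End F V | minpoly F S = m ∧ IsUnit (T - S)}.ncard =
      (Nat.card F ^ 3 - Nat.card F ^ 2 - Nat.card F) *
        (Nat.card F ^ 3 - Nat.card F ^ 2 - Nat.card F - 1) := by
  have : FiniteDimensional F V := Module.finite_of_finrank_pos (by omega)
  have : Finite (Module.End F V) := Module.finite_of_finite F
  have : Nontrivial V := Module.nontrivial_of_finrank_pos (R := F) (by omega)
  set q := Nat.card F with hq
  have hq1 : 1 < q := Finite.one_lt_card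
  set s := {S : Module.End F V | minpoly F S = m ∧ S ≠ T ∧ ¬ IsUnit (T - S)} with hs
  set d := {S : Module.End F V | minpoly F S = m ∧ IsUnit (T - S)} with hd
  have hsing : s.ncard * (q - 1) = (q ^ 3 - 1) * (q ^ 3 - q ^ 2 - 1) :=
    ncard_minpoly_eq_singular_sub_mul hmonic hirr hdeg hV hT
  have htotal : d.ncard + s.ncard + 1 = (q ^ 3 - q) * (q ^ 3 - q ^ 2) := by
    have hds : Disjoint d s := Set.disjoint_left.2 fun S h1 h2 => h2.2.2 h1.2
    have hTs : T ∉ d ∪ s := by simp [hd, hs]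
    rw [← ncard_minpoly_eq hmonic hirr hdeg hV, ← Set.ncard_union_eq hds,
      ← Set.ncard_insert_of_notMem hTs]
    congr 1
    ext S
    by_cases hST : S = T
    · simp [hST, hT]
    · simp only [hd, hs, Set.mem_insert_iff, Set.mem_union, Set.mem_ofPred_eq]
      tauto
  -- These bounds show that none of the natural subtractions truncates.
  have e1 : q ^ 2 + q + 1 ≤ q ^ 3 := by
    obtain ⟨r, hr⟩ := Nat.exists_eq_add_of_lt hq1
    rw [hr]; ring_nf; nlinarith [sq_nonneg r]
  have e2 : q ≤ q ^ 2 := by nlinarith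
  zify [show q ^ 2 ≤ q ^ 3 by omega, show q ≤ q ^ 3 by omega, show 1 ≤ q ^ 3 by omega,
    show 1 ≤ q by omega, show 1 ≤ q ^ 3 - q ^ 2 by omega, show q ≤ q ^ 3 - q ^ 2 by omega,
    show 1 ≤ q ^ 3 - q ^ 2 - q by omega] at hsing htotal ⊢
  have hs' : (s.ncard : ℤ) = (q ^ 2 + q + 1) * (q ^ 3 - q ^ 2 - 1) := by
    refine mul_right_cancel₀ (b := (q : ℤ) - 1) (by omega) ?_
    rw [hsing]
    ring
  linear_combination htotal - hs'

end Counting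

/-! ### The clique in the endomorphisms of the cubic extension -/

section FrobeniusClique

variable {F K : Type*} [Field F] [Fintype F] [Field K] [Algebra F K]

/-- The `F`-linear map `x ↦ x - κ * x ^ q`. -/
noncomputable def oneSubMulFrobenius (F : Type*) {K : Type*} [Field F] [Fintype F] [Field K]
    [Algebra F K] (κ : K) : Module.End F K :=
  1 - Algebra.lmul F K κ * (FiniteField.frobeniusAlgHom F K).toLinearMap

/-- Iterating `x = κ x^q` three times gives `x = κ^(1+q+q²) x^(q³)`, and `x^(q³) = x`. -/
theorem pow_eq_one_of_not_isUnit_oneSubMulFrobenius [FiniteDimensional F K]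
    (hK : Module.finrank F K = 3) {κ : K} (h : ¬ IsUnit (oneSubMulFrobenius F κ)) :
    κ ^ (Fintype.card F ^ 2 + Fintype.card F + 1) = 1 := by
  rw [LinearMap.isUnit_iff_ker_eq_bot, LinearMap.ker_eq_bot'] at h
  push Not at h
  obtain ⟨x, hx, hx0⟩ := h
  set q := Fintype.card F with hq
  have hx : x = κ * x ^ q := by
    simpa [oneSubMulFrobenius, sub_eq_zero] using hx
  have : Finite K := Module.finite_of_finite F
  have : Fintype K := Fintype.ofFinite K
  have hx3 : x ^ (q ^ 3) = x := by
    have := FiniteField.pow_card x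
    rwa [← Nat.card_eq_fintype_card, Module.natCard_eq_pow_finrank (K := F), hK,
      Nat.card_eq_fintype_card] at this
  have h1 : x ^ q = κ ^ q * x ^ (q ^ 2) := by
    conv_lhs => rw [hx]
    ring
  have h2 : x ^ (q ^ 2) = κ ^ (q ^ 2) * x := by
    conv_lhs => rw [hx]
    rw [mul_pow, ← pow_mul, show q * q ^ 2 = q ^ 3 by ring, hx3]
  have h3 : κ ^ (q ^ 2 + q + 1) * x = x := by
    conv_rhs => rw [hx, h1, h2]
    ring
  exact mul_right_cancel₀ hx0 (by rw [h3, one_mul])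

theorem card_pow_sub_le_ncard_isUnit_oneSubMulFrobenius [FiniteDimensional F K]
    (hK : Module.finrank F K = 3) :
    Fintype.card F ^ 3 - (Fintype.card F ^ 2 + Fintype.card F + 1) ≤
      {κ : K | IsUnit (oneSubMulFrobenius F κ)}.ncard := by
  classical
  set q := Fintype.card F with hq
  have : Finite K := Module.finite_of_finite F
  have hcard : Nat.card K = q ^ 3 := by
    rw [Module.natCard_eq_pow_finrank (K := F), hK, Nat.card_eq_fintype_card]
  have hle : {κ : K | IsUnit (oneSubMulFrobenius F κ)}ᶜ.ncard ≤ q ^ 2 + q + 1 := by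
    refine le_trans (Set.ncard_le_ncard (t := ↑(nthRootsFinset (q ^ 2 + q + 1) (1 : K))) ?_ ?_) ?_
    · intro κ hκ
      have := pow_eq_one_of_not_isUnit_oneSubMulFrobenius hK hκ
      simpa [mem_nthRootsFinset] using this
    · exact Set.toFinite _
    · rw [Set.ncard_coe_finset, nthRootsFinset_def]
      exact (Multiset.toFinset_card_le _).trans (card_nthRoots _ _)
  have := Set.ncard_add_ncard_compl {κ : K | IsUnit (oneSubMulFrobenius F κ)}
  omega

/-- `X^q - X` already splits over `F`, so all its roots in `K` come from `F`. -/
theorem pow_card_ne_self_of_notMem_range {α : K} (hα : α ∉ Set.range (algebraMap F K)) :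
    α ^ Fintype.card F ≠ α := fun h => by
  have hsplits : (X ^ Fintype.card F - X : F[X]).Splits := by
    rw [splits_iff_card_roots, FiniteField.roots_X_pow_card_sub_X,
      FiniteField.X_pow_card_sub_X_natDegree_eq F Fintype.one_lt_card, Finset.card_val,
      Finset.card_univ]
  exact hα (hsplits.mem_range_of_isRoot
    (FiniteField.X_pow_card_sub_X_ne_zero F Fintype.one_lt_card) (by simp [h]))

theorem frobenius_isUnit [FiniteDimensional F K] :
    IsUnit ((FiniteField.frobeniusAlgHom F K).toLinearMap : Module.End F K) := by
  rw [LinearMap.isUnit_iff_ker_eq_bot, LinearMap.ker_eq_bot]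
  exact (FiniteField.frobeniusAlgHom F K).toRingHom.injective

/-- Dividing on the right by the map, when it is a unit, yields the formula defining
`frobeniusConj`. -/
theorem oneSubMulFrobenius_mul_lmul (α κ : K) :
    oneSubMulFrobenius F κ * Algebra.lmul F K α =
      Algebra.lmul F K (α ^ Fintype.card F) * oneSubMulFrobenius F κ +
        Algebra.lmul F K (α - α ^ Fintype.card F) := by
  ext x
  simp [oneSubMulFrobenius, mul_pow]
  ring

theorem lmul_injective (F : Type*) {K : Type*} [Field F] [Field K] [Algebra F K] :
    Function.Injective (Algebra.lmul F K) := fun a b h => by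
  simpa using LinearMap.congr_fun h 1

theorem isUnit_lmul (F : Type*) {K : Type*} [Field F] [Field K] [Algebra F K] {a : K}
    (ha : a ≠ 0) : IsUnit (Algebra.lmul F K a) :=
  (isUnit_iff_ne_zero.2 ha).map _

theorem minpoly_eq_of_mul_eq_mul {F A : Type*} [Field F] [Ring A] [Algebra F A] {g a b : A} (hg : IsUnit g)
    (h : g * a = b * g) : minpoly F b = minpoly F a := by
  obtain ⟨u, rfl⟩ := hg
  have hb : b = MulSemiringAction.toAlgEquiv F A (ConjAct.toConjAct u) a := by
    simp [ConjAct.units_smul_def, h]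
  rw [hb, minpoly.algEquiv_eq]

/-- The conjugate of multiplication by `α` under `x ↦ x - κ * x ^ q`. -/
noncomputable def frobeniusConj (F : Type*) {K : Type*} [Field F] [Fintype F] [Field K]
    [Algebra F K] (α κ : K) : Module.End F K :=
  Algebra.lmul F K (α ^ Fintype.card F) +
    Algebra.lmul F K (α - α ^ Fintype.card F) * Ring.inverse (oneSubMulFrobenius F κ)

theorem minpoly_frobeniusConj (α : K) {κ : K} (hκ : IsUnit (oneSubMulFrobenius F κ)) :
    minpoly F (frobeniusConj F α κ) = minpoly F α := by
  rw [← minpoly.algHom_eq (Algebra.lmul F K) (lmul_injective F) α]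
  refine minpoly_eq_of_mul_eq_mul hκ ?_
  rw [oneSubMulFrobenius_mul_lmul, frobeniusConj, add_mul, mul_assoc,
    Ring.inverse_mul_cancel _ hκ, mul_one]

/-- Frobenius itself conjugates multiplication by `α` into multiplication by `α^q`: the case `κ = ∞`
of the family. -/
theorem minpoly_lmul_pow_card [FiniteDimensional F K] (α : K) :
    minpoly F (Algebra.lmul F K (α ^ Fintype.card F)) = minpoly F α := by
  rw [← minpoly.algHom_eq (Algebra.lmul F K) (lmul_injective F) α]
  refine minpoly_eq_of_mul_eq_mul (frobenius_isUnit (F := F) (K := K)) ?_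
  ext x
  simp [mul_pow]

theorem isUnit_frobeniusConj_sub_lmul {α κ : K} (hα : α ^ Fintype.card F ≠ α)
    (hκ : IsUnit (oneSubMulFrobenius F κ)) :
    IsUnit (frobeniusConj F α κ - Algebra.lmul F K (α ^ Fintype.card F)) := by
  rw [frobeniusConj, add_sub_cancel_left]
  exact (isUnit_lmul F (sub_ne_zero.2 hα.symm)).mul hκ.ringInverse

/-- By `a⁻¹ - b⁻¹ = a⁻¹ (b - a) b⁻¹`: here `b - a` is `κ - τ` times Frobenius, hence a unit. -/
theorem isUnit_frobeniusConj_sub_frobeniusConj [FiniteDimensional F K] {α κ τ : K}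
    (hα : α ^ Fintype.card F ≠ α) (hκ : IsUnit (oneSubMulFrobenius F κ))
    (hτ : IsUnit (oneSubMulFrobenius F τ)) (hne : κ ≠ τ) :
    IsUnit (frobeniusConj F α κ - frobeniusConj F α τ) := by
  have hsub : oneSubMulFrobenius F τ - oneSubMulFrobenius F κ =
      Algebra.lmul F K (κ - τ) * (FiniteField.frobeniusAlgHom F K).toLinearMap := by
    simp only [oneSubMulFrobenius, map_sub, sub_mul]
    abel
  have h : frobeniusConj F α κ - frobeniusConj F α τ =
      Algebra.lmul F K (α - α ^ Fintype.card F) * (Ring.inverse (oneSubMulFrobenius F κ) *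
        (oneSubMulFrobenius F τ - oneSubMulFrobenius F κ) *
          Ring.inverse (oneSubMulFrobenius F τ)) := by
    rw [mul_sub, sub_mul, mul_assoc, Ring.mul_inverse_cancel _ hτ,
      Ring.inverse_mul_cancel _ hκ, mul_one, one_mul, mul_sub]
    simp only [frobeniusConj]
    abel
  rw [h, hsub]
  exact (isUnit_lmul F (sub_ne_zero.2 hα.symm)).mul ((hκ.ringInverse.mul
    ((isUnit_lmul F (sub_ne_zero.2 hne)).mul frobenius_isUnit)).mul hτ.ringInverse)

theorem exists_clique_minpoly [FiniteDimensional F K] (hK : Module.finrank F K = 3) {α : K}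
    (hα : α ∉ Set.range (algebraMap F K)) :
    ∃ S : Finset (Module.End F K),
      S.card = Fintype.card F ^ 3 - Fintype.card F ^ 2 - Fintype.card F ∧
      (∀ T ∈ S, minpoly F T = minpoly F α) ∧
      (S : Set (Module.End F K)).Pairwise fun T T' => IsUnit (T - T') := by
  classical
  have hα' := pow_card_ne_self_of_notMem_range hα
  have : Finite K := Module.finite_of_finite F
  set U := {κ : K | IsUnit (oneSubMulFrobenius F κ)} with hU
  have hUcard := card_pow_sub_le_ncard_isUnit_oneSubMulFrobenius (F := F) hK
  rw [← hU] at hUcard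
  have hne : ∀ κ ∈ U, frobeniusConj F α κ ≠ Algebra.lmul F K (α ^ Fintype.card F) :=
    fun κ hκ => sub_ne_zero.1 (isUnit_frobeniusConj_sub_lmul hα' hκ).ne_zero
  have hinj : Set.InjOn (frobeniusConj F α) U := fun κ hκ τ hτ h => by
    by_contra hκτ
    exact sub_ne_zero.1 (isUnit_frobeniusConj_sub_frobeniusConj hα' hκ hτ hκτ).ne_zero h
  let S₀ : Finset (Module.End F K) :=
    insert (Algebra.lmul F K (α ^ Fintype.card F)) (U.toFinite.toFinset.image (frobeniusConj F α))
  have hpair : (S₀ : Set (Module.End F K)).Pairwise fun T T' => IsUnit (T - T') := by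
    have hsymm : Std.Symm fun T T' : Module.End F K => IsUnit (T - T') :=
      ⟨fun T T' h => by rw [← neg_sub]; exact h.neg⟩
    simp only [S₀, Finset.coe_insert, Finset.coe_image, Set.Finite.coe_toFinset]
    rw [Set.pairwise_insert_of_symm]
    refine ⟨?_, ?_⟩
    · rintro _ ⟨κ, hκ, rfl⟩ _ ⟨τ, hτ, rfl⟩ h
      exact isUnit_frobeniusConj_sub_frobeniusConj hα' hκ hτ fun h' => h (by rw [h'])
    · rintro _ ⟨κ, hκ, rfl⟩ -
      exact hsymm.symm _ _ (isUnit_frobeniusConj_sub_lmul hα' hκ)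
  have hcard : Fintype.card F ^ 3 - Fintype.card F ^ 2 - Fintype.card F ≤ S₀.card := by
    rw [Finset.card_insert_of_notMem, Finset.card_image_of_injOn (by simpa using hinj),
      ← Set.ncard_eq_toFinset_card U]
    · omega
    · rw [Finset.mem_image]
      rintro ⟨κ, hκ, h⟩
      exact hne κ (by simpa using hκ) h
  -- Only a lower bound on `S₀` is known, so a subset of the exact size is taken.
  obtain ⟨S, hS, hScard⟩ := Finset.exists_subset_card_eq hcard
  refine ⟨S, hScard, fun T hT => ?_, hpair.mono (Finset.coe_subset.2 hS)⟩
  have hT := hS hT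
  simp only [S₀, Finset.mem_insert, Finset.mem_image, Set.Finite.mem_toFinset] at hT
  obtain rfl | ⟨κ, hκ, rfl⟩ := hT
  · exact minpoly_lmul_pow_card α
  · exact minpoly_frobeniusConj α hκ

end FrobeniusClique

/-! ### Transfer to matrices and the graph -/

section Graph

variable {F : Type*} [Field F] {m : F[X]}

theorem minpoly_toLinAlgEquiv' (A : Matrix (Fin 3) (Fin 3) F) :
    minpoly F (Matrix.toLinAlgEquiv' A) = minpoly F A :=
  minpoly.algEquiv_eq _ A

theorem isUnit_toLinAlgEquiv'_sub (A B : Matrix (Fin 3) (Fin 3) F) :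
    IsUnit (Matrix.toLinAlgEquiv' A - Matrix.toLinAlgEquiv' B) ↔ IsUnit (A - B) := by
  rw [← map_sub, MulEquiv.isUnit_map]

/-- An algebra automorphism of the matrix algebra induces an automorphism of the graph. -/
def invDiffGraphIso (m : F[X]) (e : Matrix (Fin 3) (Fin 3) F ≃ₐ[F] Matrix (Fin 3) (Fin 3) F) :
    invDiffGraph m ≃g invDiffGraph m where
  toEquiv := e.toEquiv.subtypeEquiv fun A => by
    simp [minpolyClass, minpoly.algEquiv_eq]
  map_rel_iff' {A B} := by
    change IsUnit (e A.1 - e B.1) ↔ IsUnit (A.1 - B.1)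
    rw [← map_sub, MulEquiv.isUnit_map]

theorem isVertexTransitive_invDiffGraph (hmonic : m.Monic) (hirr : Irreducible m)
    (hdeg : m.natDegree = 3) : IsVertexTransitive (invDiffGraph m) := by
  rintro ⟨A, hA⟩ ⟨B, hB⟩
  obtain ⟨e, he⟩ := exists_conj_of_minpoly_eq hmonic hirr hdeg (by simp)
    ((minpoly_toLinAlgEquiv' A).trans hA) ((minpoly_toLinAlgEquiv' B).trans hB)
  refine ⟨invDiffGraphIso m ((Matrix.toLinAlgEquiv'.trans
    (LinearEquiv.conjAlgEquiv F e)).trans Matrix.toLinAlgEquiv'.symm), Subtype.ext ?_⟩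
  change Matrix.toLinAlgEquiv'.symm (LinearEquiv.conjAlgEquiv F e (Matrix.toLinAlgEquiv' A)) = B
  rw [he, AlgEquiv.symm_apply_apply]

theorem card_minpolyClass [Finite F] (hmonic : m.Monic) (hirr : Irreducible m)
    (hdeg : m.natDegree = 3) :
    Nat.card (minpolyClass 3 m) =
      (Nat.card F ^ 3 - Nat.card F) * (Nat.card F ^ 3 - Nat.card F ^ 2) := by
  rw [← ncard_minpoly_eq (V := Fin 3 → F) hmonic hirr hdeg (by simp)]
  refine Nat.card_congr ((Matrix.toLinAlgEquiv' (R := F) (n := Fin 3)).toEquiv.subtypeEquiv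
    fun A => ?_)
  simp [minpolyClass, minpoly.algEquiv_eq]

theorem isRegularOfDegree_invDiffGraph [Finite F] (hmonic : m.Monic) (hirr : Irreducible m)
    (hdeg : m.natDegree = 3) :
    (invDiffGraph m).IsRegularOfDegree
      ((Nat.card F ^ 3 - Nat.card F ^ 2 - Nat.card F) *
        (Nat.card F ^ 3 - Nat.card F ^ 2 - Nat.card F - 1)) := by
  intro A
  rw [← ncard_minpoly_eq_isUnit_sub (V := Fin 3 → F) hmonic hirr hdeg (by simp)
    ((minpoly_toLinAlgEquiv' A.1).trans A.2), ← SimpleGraph.card_neighborSet_eq_degree,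
    ← Nat.card_eq_fintype_card]
  refine Set.ncard_congr (s := (invDiffGraph m).neighborSet A)
    (fun B _ => Matrix.toLinAlgEquiv' B.1) ?_ ?_ ?_
  · intro B hB
    exact ⟨(minpoly_toLinAlgEquiv' B.1).trans B.2, (isUnit_toLinAlgEquiv'_sub _ _).2 hB⟩
  · intro B C _ _ h
    exact Subtype.ext (Matrix.toLinAlgEquiv'.injective h)
  · rintro S ⟨hS, hAS⟩
    obtain ⟨B, rfl⟩ := Matrix.toLinAlgEquiv'.surjective S
    exact ⟨⟨B, (minpoly_toLinAlgEquiv' B).symm.trans hS⟩, (isUnit_toLinAlgEquiv'_sub _ _).1 hAS,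
      rfl⟩

theorem exists_isNClique_invDiffGraph [Finite F] (hmonic : m.Monic) (hirr : Irreducible m)
    (hdeg : m.natDegree = 3) :
    ∃ s : Finset (minpolyClass 3 m),
      (invDiffGraph m).IsNClique (Nat.card F ^ 3 - Nat.card F ^ 2 - Nat.card F) s := by
  classical
  have : Fintype F := Fintype.ofFinite F
  have : Fact (Irreducible m) := ⟨hirr⟩
  obtain ⟨b, hdim⟩ : ∃ b : PowerBasis F (AdjoinRoot m), b.dim = 3 :=
    ⟨AdjoinRoot.powerBasis hmonic.ne_zero, by rw [AdjoinRoot.powerBasis_dim, hdeg]⟩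
  have : FiniteDimensional F (AdjoinRoot m) := b.finite
  have hα : minpoly F (AdjoinRoot.root m) = m := by
    rw [AdjoinRoot.minpoly_root hmonic.ne_zero, hmonic.leadingCoeff, inv_one, C_1, mul_one]
  have hnot : AdjoinRoot.root m ∉ Set.range (algebraMap F (AdjoinRoot m)) := by
    rintro ⟨a, ha⟩
    rw [← ha, minpoly.eq_X_sub_C] at hα
    rw [← hα, natDegree_X_sub_C] at hdeg
    omega
  obtain ⟨S, hcard, hS, hpair⟩ := exists_clique_minpoly (by rw [b.finrank, hdim]) hnot
  -- A basis of `K` over `F` carries the clique to matrices, preserving minimal polynomials and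
  -- units.
  obtain ⟨e⟩ : Nonempty (Module.End F (AdjoinRoot m) ≃ₐ[F] Matrix (Fin 3) (Fin 3) F) :=
    ⟨LinearMap.toMatrixAlgEquiv (b.basis.reindex (finCongr hdim))⟩
  have hmem : ∀ T ∈ S, e T ∈ minpolyClass 3 m := fun T hT => by
    rw [minpolyClass, Set.mem_ofPred_eq, minpoly.algEquiv_eq, hS T hT, hα]
  refine ⟨S.attach.map ⟨fun T => ⟨e T.1, hmem T.1 T.2⟩, fun T T' h =>
    Subtype.ext (e.injective (congrArg Subtype.val h))⟩, ⟨?_, ?_⟩⟩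
  · intro A hA B hB hAB
    simp only [Finset.coe_map, Set.mem_image] at hA hB
    obtain ⟨T, -, rfl⟩ := hA
    obtain ⟨T', -, rfl⟩ := hB
    have hu := hpair T.2 T'.2 fun h => hAB (by rw [Subtype.ext h])
    change IsUnit (e T.1 - e T'.1)
    rw [← map_sub]
    exact hu.map e
  · rw [Finset.card_map, Finset.card_attach, hcard, Nat.card_eq_fintype_card]

end Graph

theorem mainTheorem11 {F : Type*} [Field F] [Finite F] (q : ℕ) (hq : Nat.card F = q)
    (m : F[X]) (hmonic : m.Monic) (hirr : Irreducible m) (hdeg : m.natDegree = 3) :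
    Nat.card (minpolyClass 3 m) = (q ^ 3 - q) * (q ^ 3 - q ^ 2) ∧
    IsVertexTransitive (invDiffGraph m) ∧
    (invDiffGraph m).IsRegularOfDegree ((q ^ 3 - q ^ 2 - q) * (q ^ 3 - q ^ 2 - q - 1)) ∧
    ∃ s : Finset (minpolyClass 3 m), (invDiffGraph m).IsNClique (q ^ 3 - q ^ 2 - q) s := by
  subst hq
  exact ⟨card_minpolyClass hmonic hirr hdeg, isVertexTransitive_invDiffGraph hmonic hirr hdeg,
    isRegularOfDegree_invDiffGraph hmonic hirr hdeg,
    exists_isNClique_invDiffGraph hmonic hirr hdeg⟩
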